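/- Let $(W,S)$ be a Coxeter system of finite rank $n=|S|$: $S$ is a finite set, and $W$ is the group with presentation $$W=\langle S \mid (st)^{m_{st}}=1 \text{ for all } s,t\in S\rangle,$$ where $(m_{st})_{s,t\in S}$ is a symmetric matrix with entries in $\mathbb{Z}_{\ge 1}\cup\{\infty\}$, $m_{ss}=1$ for all $s \in S$, $m_{st}\ge 2$ for all $s\ne t$, and there is no relation for $st$ when $m_{st}=\infty$. Assume that $W$ is infinite and that $(W,S)$ is irreducible, that is, the graph with vertex set $S$ in which distinct $s,t$ are joined by an edge if and only if $m_{st}>2$ (including $m_{st}=\infty$) is connected. Let $I\subseteq S$ be a subset with $|I|=n-1$, and let $W_I=\langle I\rangle$ be the standard parabolic subgroup of $W$ generated by $I$. Then $W_I$ is self-normalizing, i.e. $N_W(W_I)=W_I$. -/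

import Mathlib

namespace CoxeterMatrix

/-- The (unlabelled) Coxeter diagram of a Coxeter matrix `M`: its vertices are the indices of the
generators, and two distinct vertices `i`, `j` are joined iff `m_{ij} > 2`. In `CoxeterMatrix` the
value `m_{ij} = ∞` is encoded as `0`. -/
def diagram {B : Type*} (M : CoxeterMatrix B) : SimpleGraph B where
  Adj i j := i ≠ j ∧ (2 < M i j ∨ M i j = 0)
  symm := ⟨fun i j h => ⟨h.1.symm, by rw [M.symmetric j i]; exact h.2⟩⟩
  loopless := ⟨fun _ h => h.1 rfl⟩

/-- A Coxeter matrix is irreducible if its Coxeter diagram is connected. -/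
def IsIrreducible {B : Type*} (M : CoxeterMatrix B) : Prop :=
  M.diagram.Connected

end CoxeterMatrix

namespace CoxeterSystem

/-- The standard parabolic subgroup `W_I`, generated by the simple reflections indexed by `I`. -/
def standardParabolic {B W : Type*} [Group W] {M : CoxeterMatrix B} (cs : CoxeterSystem M W)
    (I : Set B) : Subgroup W :=
  Subgroup.closure (cs.simple '' I)

end CoxeterSystem

/-!
Let `r` be the generator missing from `I`, and suppose that some element outside `W_I` normalizes
`W_I`. Its coset contains an element `w ≠ 1` of minimal length. As `w W_I = W_I w`, lengths add in
`w x` and in `x w` for `x ∈ W_I`; the only right descent of `w` is `r`, so `r` is a right descent of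
every `w x` (`CoxeterSystem.isRightDescent_mul_of_mem_normalizer`). By the exchange condition the
reflection `x r x⁻¹` then occurs in the right inversion sequence of a fixed word for `w`, so `r` has
only finitely many conjugates under `W_I`.

The elements of `W_I` commuting with all these conjugates form a subgroup normalized both by `W_I`
and by `r`, hence normal in `W`. Irreducibility makes it trivial
(`CoxeterSystem.eq_bot_of_normal_of_le_standardParabolic`): if `s ∉ J` and both `g` and `s g s` lie
in `W_J`, then `g` is a product of generators commuting with `s`, so a normal subgroup whose elements
do not involve `s` does not involve the neighbours of `s` in the diagram either, and it starts out
not involving `r`. Hence `W_I` acts faithfully on a finite set and is finite. If `x` is a longest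
element of `W_I`, every generator is a right descent of `w x`, and this forces `W` to be finite
(`CoxeterSystem.finite_of_forall_isRightDescent`).

Two inputs on general Coxeter systems are developed here. The geometric representation shows that
simple reflections adjacent in the diagram do not commute and that `s_i ∈ W_J` implies `i ∈ J`. The
action of `W` on `W × ZMod 2` which records the parity of multiplicities in right inversion sequences
yields the exchange condition `CoxeterSystem.simple_mem_rightInvSeq`.
-/

/-! ### The geometric representation -/

namespace CoxeterMatrix

variable {B : Type*} (M : CoxeterMatrix B)

open Module

/-- The linear form `v ↦ 2 B(e_i, v)`, where `B(e_i, e_j) = -cos (π / M i j)`. For `M i j = 0`, which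
encodes `∞`, the convention `π / 0 = 0` gives the correct value `B(e_i, e_j) = -1`. -/
noncomputable def coroot (i : B) : Dual ℝ (B →₀ ℝ) :=
  Finsupp.linearCombination ℝ fun j => -2 * Real.cos (Real.pi / M i j)

/-- The `i`-th basis vector of the space of the geometric representation. -/
noncomputable def root (i : B) : B →₀ ℝ := Finsupp.single i 1

@[simp] lemma root_apply_self (i : B) : root i i = 1 := by simp [root]

lemma root_apply_of_ne {i j : B} (h : j ≠ i) : root i j = 0 := by
  simp [root, h]

lemma coroot_root (i j : B) : M.coroot i (root j) = -2 * Real.cos (Real.pi / M i j) := by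
  simp [coroot, root]

lemma coroot_root_self (i : B) : M.coroot i (root i) = 2 := by
  simp [coroot_root]

lemma reflection_mul_reflection_pow_eq_one (i j : B) :
    (reflection (M.coroot_root_self i) * reflection (M.coroot_root_self j)) ^ M i j = 1 := by
  have hsym : M.coroot j (root i) = M.coroot i (root j) := by
    rw [coroot_root, coroot_root, M.symmetric]
  rcases eq_or_ne i j with rfl | hij
  · ext1 v
    rw [M.diagonal, pow_one, LinearEquiv.mul_apply]
    exact involutive_reflection _ v
  have h1 := M.off_diagonal i j hij
  obtain h0 | h2 | h3 : M i j = 0 ∨ M i j = 2 ∨ 3 ≤ M i j := by omega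
  · rw [h0, pow_zero]
  · have hc : M.coroot i (root j) = 0 := by simp [coroot_root, h2]
    ext1 v
    rw [h2, pow_two]
    simp only [LinearEquiv.mul_apply, LinearEquiv.coe_one, id, reflection_apply, map_sub, map_smul,
      hsym, hc, M.coroot_root_self]
    module
  · have hm : (3 : ℝ) ≤ M i j := by exact_mod_cast h3
    set θ : ℝ := 2 * (Real.pi / M i j) with hθ
    have hsin : Real.sin θ ≠ 0 := by
      apply ne_of_gt
      apply Real.sin_pos_of_pos_of_lt_pi
      · positivity
      · rw [hθ, ← mul_div_assoc, div_lt_iff₀ (by linarith)]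
        nlinarith [Real.pi_pos]
    have hmθ : (M i j : ℝ) * θ = 2 * Real.pi := by rw [hθ]; field_simp
    have ht : 2 * Real.cos θ = M.coroot i (root j) * M.coroot j (root i) - 2 := by
      rw [hsym, coroot_root, hθ, Real.cos_two_mul]; ring
    ext1 z
    rw [reflection_mul_reflection_pow_apply _ _ _ z _ ht]
    -- `sin θ` times the value at `2 cos θ` of the polynomial `S k` is `sin ((k + 1) θ)`
    have hS := fun k : ℤ => Polynomial.Chebyshev.S_two_mul_real_cos θ k
    obtain ⟨k, hk | hk⟩ := Nat.even_or_odd' (M i j)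
    · have e1 : ((M i j : ℤ) - 2) / 2 = k - 1 := by omega
      have e2 : ((M i j : ℤ) - 1) / 2 = k - 1 := by omega
      have hz : (Polynomial.Chebyshev.S ℝ (k - 1 : ℤ)).eval (2 * Real.cos θ) = 0 := by
        apply (mul_eq_zero.1 ((hS _).trans _)).resolve_right hsin
        rw [hk] at hmθ
        have : ((((k : ℤ) - 1 : ℤ) : ℝ) + 1) * θ = Real.pi := by push_cast at hmθ ⊢; linarith
        rw [this, Real.sin_pi]
      rw [e1, e2, hz]
      simp
    · have e1 : ((M i j : ℤ) - 2) / 2 = k - 1 := by omega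
      have e2 : ((M i j : ℤ) - 1) / 2 = k := by omega
      have e3 : ((M i j : ℤ) - 3) / 2 = k - 1 := by omega
      have e4 : (M i j : ℤ) / 2 = k := by omega
      have hz : (Polynomial.Chebyshev.S ℝ (k : ℤ)).eval (2 * Real.cos θ) +
          (Polynomial.Chebyshev.S ℝ (k - 1 : ℤ)).eval (2 * Real.cos θ) = 0 := by
        refine (mul_eq_zero.1 (?_ : _ * Real.sin θ = 0)).resolve_right hsin
        rw [add_mul, hS, hS]
        rw [hk] at hmθ
        have : (((k : ℤ) : ℝ) + 1) * θ = 2 * Real.pi - ((((k : ℤ) - 1 : ℤ) : ℝ) + 1) * θ := by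
          push_cast at hmθ ⊢; linarith
        rw [this, Real.sin_two_pi_sub]; ring
      rw [e1, e2, e3, e4, hz]
      simp

end CoxeterMatrix

namespace CoxeterSystem

open CoxeterMatrix Module

variable {B W : Type*} [Group W] {M : CoxeterMatrix B} (cs : CoxeterSystem M W)

/-- The geometric representation of a Coxeter group, in which the simple reflection `s_i` acts by
`v ↦ v - 2 B(e_i, v) e_i`. -/
noncomputable def geomRep : W →* ((B →₀ ℝ) ≃ₗ[ℝ] (B →₀ ℝ)) :=
  cs.lift ⟨fun i => reflection (M.coroot_root_self i), M.reflection_mul_reflection_pow_eq_one⟩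

lemma geomRep_simple (i : B) (v : B →₀ ℝ) :
    cs.geomRep (cs.simple i) v = v - M.coroot i v • root i := by
  rw [geomRep, cs.lift_apply_simple M.reflection_mul_reflection_pow_eq_one, reflection_apply]

lemma simple_injective : Function.Injective cs.simple := by
  intro i j h
  by_contra hij
  have h1 := cs.geomRep_simple i (root i)
  rw [h, geomRep_simple, coroot_root_self] at h1
  have h2 := DFunLike.congr_fun h1 i
  simp only [Finsupp.sub_apply, Finsupp.smul_apply, root_apply_self, root_apply_of_ne hij,
    smul_eq_mul] at h2
  norm_num at h2

/-- Commuting simple reflections are orthogonal in the geometric representation. -/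
lemma not_adj_of_commute {i j : B} (h : Commute (cs.simple i) (cs.simple j)) :
    ¬ M.diagram.Adj i j := by
  rintro ⟨hij, hM⟩
  have h1 : cs.geomRep (cs.simple i * cs.simple j) (root i) =
      cs.geomRep (cs.simple j * cs.simple i) (root i) := by rw [h.eq]
  simp only [map_mul, LinearEquiv.mul_apply, geomRep_simple, map_sub, map_smul,
    coroot_root_self] at h1
  have h2 := DFunLike.congr_fun h1 i
  simp only [coroot_root, M.symmetric j i, Finsupp.sub_apply, Finsupp.smul_apply,
    root_apply_self, root_apply_of_ne hij, smul_eq_mul] at h2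
  have h3 : Real.cos (Real.pi / M i j) ^ 2 = 0 := by linarith
  have h4 : 0 < Real.cos (Real.pi / M i j) := by
    rcases hM with hM | hM
    · have hm : (2 : ℝ) < M i j := by exact_mod_cast hM
      apply Real.cos_pos_of_mem_Ioo
      constructor
      · have : 0 < Real.pi / M i j := by have := Real.pi_pos; positivity
        linarith [Real.pi_pos]
      · exact div_lt_div_of_pos_left Real.pi_pos two_pos hm
    · simp [hM]
  exact h4.ne' (pow_eq_zero_iff two_ne_zero |>.1 h3)

/-- An element of `W_J` moves every vector by a linear combination of the `e_j` with `j ∈ J`. -/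
lemma geomRep_sub_mem_span {J : Set B} {w : W} (hw : w ∈ cs.standardParabolic J) :
    ∀ v, cs.geomRep w v - v ∈ Submodule.span ℝ (root '' J) := by
  induction hw using Subgroup.closure_induction with
  | mem x hx =>
    obtain ⟨i, hi, rfl⟩ := hx
    intro v
    rw [geomRep_simple, sub_sub_cancel_left]
    exact neg_mem (Submodule.smul_mem _ _ (Submodule.subset_span ⟨i, hi, rfl⟩))
  | one => simp
  | mul x y _ _ hx hy =>
    intro v
    have := add_mem (hx (cs.geomRep y v)) (hy v)
    rwa [sub_add_sub_cancel, ← LinearEquiv.mul_apply, ← map_mul] at this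
  | inv x _ hx =>
    intro v
    have := neg_mem (hx (cs.geomRep x⁻¹ v))
    rwa [← LinearEquiv.mul_apply, ← map_mul, mul_inv_cancel, map_one, neg_sub] at this

lemma mem_of_simple_mem_standardParabolic {J : Set B} {i : B}
    (h : cs.simple i ∈ cs.standardParabolic J) : i ∈ J := by
  by_contra hi
  have h1 := cs.geomRep_sub_mem_span h (root i)
  have h2 : Submodule.span ℝ (root '' J) ≤ LinearMap.ker (Finsupp.lapply i : (B →₀ ℝ) →ₗ[ℝ] ℝ) := by
    rw [Submodule.span_le]
    rintro _ ⟨j, hj, rfl⟩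
    exact root_apply_of_ne fun e => hi (e ▸ hj)
  have h3 := h2 h1
  rw [geomRep_simple, coroot_root_self] at h3
  norm_num at h3

end CoxeterSystem

/-! ### The exchange condition -/

namespace CoxeterSystem

open CoxeterMatrix List

variable {B W : Type*} [Group W] {M : CoxeterMatrix B} (cs : CoxeterSystem M W)

open Classical in
/-- The action of the simple reflection `s_i` on `W × ZMod 2`: conjugation on the first factor, and
a shift by `1` of the second where the first is `s_i` itself. -/
noncomputable def signedConj (i : B) : Function.End (W × ZMod 2) :=
  fun p => (cs.simple i * p.1 * cs.simple i, p.2 + if p.1 = cs.simple i then 1 else 0)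

open Classical in
/-- The second component counts the occurrences of `p.1` among the `2 m` elements
`s_j (s_i s_j) ^ l`. For `m = M i j` each element is listed twice, so that the braid relations hold
modulo `2`. -/
lemma signedConj_mul_pow (i j : B) (m : ℕ) (p : W × ZMod 2) :
    ((cs.signedConj i * cs.signedConj j : Function.End (W × ZMod 2)) ^ m) p =
      ((cs.simple i * cs.simple j) ^ m * p.1 * ((cs.simple i * cs.simple j) ^ m)⁻¹,
        p.2 + ∑ l ∈ Finset.range (2 * m),
          if p.1 = cs.simple j * (cs.simple i * cs.simple j) ^ l then 1 else 0) := by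
  have hinv : (cs.simple i * cs.simple j)⁻¹ = cs.simple j * cs.simple i := by simp
  have key : ∀ m, ((cs.simple i * cs.simple j) ^ m)⁻¹ * cs.simple j =
      cs.simple j * (cs.simple i * cs.simple j) ^ m := by
    intro m
    induction m with
    | zero => simp
    | succ m ih =>
      calc _ = ((cs.simple i * cs.simple j) ^ m)⁻¹ *
            ((cs.simple i * cs.simple j)⁻¹ * cs.simple j) := by
              rw [← mul_assoc, ← mul_inv_rev, ← pow_succ']
        _ = ((cs.simple i * cs.simple j) ^ m)⁻¹ * cs.simple j *
            (cs.simple i * cs.simple j) := by rw [hinv]; simp only [mul_assoc]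
        _ = _ := by rw [ih, mul_assoc, ← pow_succ]
  induction m with
  | zero => simp; rfl
  | succ m ih =>
    rw [pow_succ']
    change cs.signedConj i (cs.signedConj j (_ : W × ZMod 2)) = _
    rw [ih]
    set r := cs.simple i * cs.simple j with hr
    have c1 : r ^ m * p.1 * (r ^ m)⁻¹ = cs.simple j ↔ p.1 = cs.simple j * r ^ (2 * m) := by
      rw [mul_inv_eq_iff_eq_mul, ← eq_inv_mul_iff_mul_eq, ← mul_assoc, key, mul_assoc, ← pow_add,
        two_mul]
    have c2 : cs.simple j * (r ^ m * p.1 * (r ^ m)⁻¹) * cs.simple j = cs.simple i ↔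
        p.1 = cs.simple j * r ^ (2 * m + 1) := by
      rw [← eq_mul_inv_iff_mul_eq, ← eq_inv_mul_iff_mul_eq, mul_inv_eq_iff_eq_mul,
        ← eq_inv_mul_iff_mul_eq, inv_simple, ← hr]
      rw [← mul_assoc, ← mul_assoc, key, mul_assoc, mul_assoc, ← pow_succ', ← pow_add,
        show m + (m + 1) = 2 * m + 1 by ring]
    simp only [signedConj]
    rw [show 2 * (m + 1) = 2 * m + 1 + 1 by ring, Finset.sum_range_succ, Finset.sum_range_succ]
    simp only [c1, c2]
    refine Prod.ext ?_ ?_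
    · have : (r ^ (m + 1))⁻¹ = (r ^ m)⁻¹ * (cs.simple j * cs.simple i) := by
        rw [pow_succ', mul_inv_rev, hinv]
      have h' : r ^ (m + 1) = cs.simple i * (cs.simple j * r ^ m) := by
        rw [pow_succ' r m, hr, mul_assoc]
      change _ = r ^ (m + 1) * p.1 * (r ^ (m + 1))⁻¹
      rw [this, h']
      simp only [mul_assoc]
    · simp only [add_assoc]

lemma isLiftable_signedConj : M.IsLiftable cs.signedConj := by
  classical
  intro i j
  funext p
  rw [signedConj_mul_pow, cs.simple_mul_simple_pow, two_mul, Finset.sum_range_add]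
  simp only [pow_add, cs.simple_mul_simple_pow, one_mul, CharTwo.add_self_eq_zero]
  simp
  rfl

open Classical in
/-- The parity of the multiplicity of `t` in the right inversion sequence of a word depends only on
the product of the word. -/
lemma lift_signedConj_wordProd (ω : List B) (p : W × ZMod 2) :
    cs.lift ⟨cs.signedConj, cs.isLiftable_signedConj⟩ (cs.wordProd ω) p =
      (cs.wordProd ω * p.1 * (cs.wordProd ω)⁻¹, p.2 + ((cs.rightInvSeq ω).count p.1 : ZMod 2)) := by
  induction ω with
  | nil => simp; rfl
  | cons i ω ih =>
    rw [wordProd_cons, map_mul, cs.lift_apply_simple cs.isLiftable_signedConj]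
    change cs.signedConj i (_ : W × ZMod 2) = _
    rw [ih, rightInvSeq, count_cons]
    have c : cs.wordProd ω * p.1 * (cs.wordProd ω)⁻¹ = cs.simple i ↔
        (cs.wordProd ω)⁻¹ * cs.simple i * cs.wordProd ω = p.1 := by
      rw [mul_inv_eq_iff_eq_mul, ← eq_inv_mul_iff_mul_eq, eq_comm, mul_assoc]
    simp only [signedConj, c, beq_iff_eq]
    refine Prod.ext ?_ ?_
    · simp [mul_assoc]
    · push_cast
      simp only [add_assoc]

/-- The exchange condition: a right descent of the product of a word occurs in the right inversion
sequence of the word, which need not be reduced. -/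
lemma simple_mem_rightInvSeq {ω : List B} {i : B} (h : cs.IsRightDescent (cs.wordProd ω) i) :
    cs.simple i ∈ cs.rightInvSeq ω := by
  classical
  by_contra hi
  obtain ⟨ω', hω', hw⟩ := cs.exists_isReduced (cs.wordProd ω * cs.simple i)
  have h1 := congrArg Prod.snd (cs.lift_signedConj_wordProd ω' (cs.simple i, 0))
  have h2 : cs.lift ⟨cs.signedConj, cs.isLiftable_signedConj⟩ (cs.wordProd ω') (cs.simple i, 0) =
      cs.lift ⟨cs.signedConj, cs.isLiftable_signedConj⟩ (cs.wordProd ω)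
        (cs.signedConj i (cs.simple i, 0)) := by
    rw [← hw, map_mul, cs.lift_apply_simple cs.isLiftable_signedConj]
    rfl
  rw [h2, lift_signedConj_wordProd] at h1
  have h3 : cs.simple i ∈ cs.rightInvSeq ω' := by
    by_contra h3
    simp [signedConj, count_eq_zero_of_not_mem hi, count_eq_zero_of_not_mem h3] at h1
  have h4 := (cs.isRightInversion_of_mem_rightInvSeq hω' h3).2
  rw [← hw, cs.simple_mul_simple_cancel_right] at h4
  exact lt_asymm h h4

lemma mem_rightInvSeq_append {ω ω' : List B} {t : W} :
    t ∈ cs.rightInvSeq (ω ++ ω') ↔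
      cs.wordProd ω' * t * (cs.wordProd ω')⁻¹ ∈ cs.rightInvSeq ω ∨ t ∈ cs.rightInvSeq ω' := by
  induction ω with
  | nil => simp
  | cons i ω ih =>
    simp only [cons_append, rightInvSeq, mem_cons, ih, wordProd_append, or_assoc]
    refine or_congr_left ?_
    rw [mul_inv_eq_iff_eq_mul, ← eq_inv_mul_iff_mul_eq]
    simp [mul_assoc]

/-- The exchange condition for a right descent of a product `π ω * u`. -/
lemma isRightDescent_or_conj_mem_rightInvSeq {ω : List B} {u : W} {i : B}
    (h : cs.IsRightDescent (cs.wordProd ω * u) i) :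
    cs.IsRightDescent u i ∨ u * cs.simple i * u⁻¹ ∈ cs.rightInvSeq ω := by
  obtain ⟨ω', hω', rfl⟩ := cs.exists_isReduced u
  rw [← wordProd_append] at h
  rcases cs.mem_rightInvSeq_append.1 (cs.simple_mem_rightInvSeq h) with h | h
  · exact Or.inr h
  · exact Or.inl (cs.isRightInversion_of_mem_rightInvSeq hω' h).2

/-- If `w u` is shortened by `s_i` on the right, then so is `u`, or the reflection `u s_i u⁻¹`
shortens `w`. -/
lemma isRightDescent_or_length_lt {w u : W} {i : B} (h : cs.IsRightDescent (w * u) i) :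
    cs.IsRightDescent u i ∨ cs.length (w * (u * cs.simple i * u⁻¹)) < cs.length w := by
  obtain ⟨ω, hω, rfl⟩ := cs.exists_isReduced w
  exact (cs.isRightDescent_or_conj_mem_rightInvSeq h).imp_right
    fun h => (cs.isRightInversion_of_mem_rightInvSeq hω h).2

/-! ### Lengths and finiteness -/

/-- Induction along reduced words, read from left to right. -/
lemma length_induction {p : W → Prop} (one : p 1)
    (mul_simple : ∀ u i, cs.length (u * cs.simple i) = cs.length u + 1 → p u →
      p (u * cs.simple i)) (w : W) : p w := by
  induction hn : cs.length w using Nat.strong_induction_on generalizing w with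
  | _ n ih =>
    rcases eq_or_ne w 1 with rfl | hw
    · exact one
    · obtain ⟨i, hi⟩ := cs.exists_rightDescent_of_ne_one hw
      have h := cs.isRightDescent_iff.1 hi
      have := mul_simple (w * cs.simple i) i (by simpa using h.symm) (ih _ (hn ▸ hi) _ rfl)
      simpa using this

/-- A Coxeter group of finite rank is finite if one of its elements is shortened by every simple
reflection: that element is then a longest one. -/
lemma finite_of_forall_isRightDescent [Finite B] {z : W} (hz : ∀ i, cs.IsRightDescent z i) :
    Finite W := by
  have key : ∀ u, cs.length (z * u⁻¹) + cs.length u ≤ cs.length z := by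
    intro u
    induction u using cs.length_induction with
    | one => simp
    | mul_simple u i hu ih =>
      have h1 : cs.IsRightDescent (z * u⁻¹ * u) i := by simpa using hz i
      rcases cs.isRightDescent_or_length_lt h1 with h | h
      · exact absurd h (by rw [IsRightDescent]; omega)
      · have : z * u⁻¹ * (u * cs.simple i * u⁻¹) = z * (u * cs.simple i)⁻¹ := by simp [mul_assoc]
        rw [this] at h
        omega
  refine Set.finite_univ_iff.1 (((List.finite_length_le B (cs.length z)).image
    cs.wordProd).subset fun u _ => ?_)
  obtain ⟨ω, hω, rfl⟩ := cs.exists_isReduced u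
  have h := key (cs.wordProd ω)
  rw [hω.eq] at h
  exact ⟨ω, le_of_add_le_right h, rfl⟩

/-! ### Standard parabolic subgroups -/

lemma simple_mem_standardParabolic {J : Set B} {i : B} (hi : i ∈ J) :
    cs.simple i ∈ cs.standardParabolic J :=
  Subgroup.subset_closure ⟨i, hi, rfl⟩

lemma exists_word_of_mem_standardParabolic {J : Set B} {w : W} (hw : w ∈ cs.standardParabolic J) :
    ∃ ω : List B, (∀ i ∈ ω, i ∈ J) ∧ cs.wordProd ω = w := by
  induction hw using Subgroup.closure_induction with
  | mem x hx =>
    obtain ⟨i, hi, rfl⟩ := hx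
    exact ⟨[i], by simpa using hi, by simp⟩
  | one => exact ⟨[], by simp, by simp⟩
  | mul x y _ _ hx hy =>
    obtain ⟨ω, h, rfl⟩ := hx
    obtain ⟨ω', h', rfl⟩ := hy
    exact ⟨ω ++ ω', by simpa [or_imp, forall_and] using ⟨h, h'⟩, cs.wordProd_append _ _⟩
  | inv x _ hx =>
    obtain ⟨ω, h, rfl⟩ := hx
    exact ⟨ω.reverse, by simpa using h, cs.wordProd_reverse _⟩

lemma wordProd_mem_standardParabolic {J : Set B} {ω : List B} (h : ∀ i ∈ ω, i ∈ J) :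
    cs.wordProd ω ∈ cs.standardParabolic J := by
  apply Subgroup.list_prod_mem
  simp only [mem_map]
  rintro _ ⟨i, hi, rfl⟩
  exact cs.simple_mem_standardParabolic (h i hi)

lemma mem_standardParabolic_of_mem_rightInvSeq {J : Set B} {ω : List B} (h : ∀ i ∈ ω, i ∈ J)
    {t : W} (ht : t ∈ cs.rightInvSeq ω) : t ∈ cs.standardParabolic J := by
  induction ω with
  | nil => simp at ht
  | cons i ω ih =>
    rw [forall_mem_cons] at h
    rcases mem_cons.1 ht with rfl | ht
    · have := cs.wordProd_mem_standardParabolic h.2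
      exact mul_mem (mul_mem (inv_mem this) (cs.simple_mem_standardParabolic h.1)) this
    · exact ih h.2 ht

lemma mem_of_isRightDescent {J : Set B} {w : W} {i : B} (hw : w ∈ cs.standardParabolic J)
    (hi : cs.IsRightDescent w i) : i ∈ J := by
  obtain ⟨ω, hω, rfl⟩ := cs.exists_word_of_mem_standardParabolic hw
  exact cs.mem_of_simple_mem_standardParabolic
    (cs.mem_standardParabolic_of_mem_rightInvSeq hω (cs.simple_mem_rightInvSeq hi))

/-- `cs.length_induction` within a standard parabolic subgroup. -/
lemma standardParabolic_induction {J : Set B} {p : W → Prop} (one : p 1)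
    (mul_simple : ∀ u ∈ cs.standardParabolic J, ∀ i ∈ J,
      cs.length (u * cs.simple i) = cs.length u + 1 → p u → p (u * cs.simple i))
    {w : W} (hw : w ∈ cs.standardParabolic J) : p w := by
  induction w using cs.length_induction with
  | one => exact one
  | mul_simple u i h ih =>
    have hi : i ∈ J := cs.mem_of_isRightDescent hw (by simp [IsRightDescent, h])
    have hu : u ∈ cs.standardParabolic J := by
      simpa using mul_mem hw (cs.simple_mem_standardParabolic hi)
    exact mul_simple u hu i hi h (ih hu)

/-- If `w` has minimal length in `w W_J`, then lengths add in products `w x` with `x ∈ W_J`. -/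
lemma length_mul_of_forall_length_le {J : Set B} {w : W}
    (hw : ∀ x ∈ cs.standardParabolic J, cs.length w ≤ cs.length (w * x)) {x : W}
    (hx : x ∈ cs.standardParabolic J) : cs.length (w * x) = cs.length w + cs.length x := by
  refine cs.standardParabolic_induction
    (p := fun x => cs.length (w * x) = cs.length w + cs.length x) (by simp) ?_ hx
  · intro u hu i hi h ih
    rw [← mul_assoc]
    rcases cs.length_mul_simple (w * u) i with h1 | h1
    · omega
    · rcases cs.isRightDescent_or_length_lt (w := w) (u := u) (i := i)
        (by rw [IsRightDescent]; omega) with h2 | h2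
      · rw [IsRightDescent] at h2; omega
      · have := hw _ (mul_mem (mul_mem hu (cs.simple_mem_standardParabolic hi)) (inv_mem hu))
        omega

/-- Since `s` is not a right descent of `s t s ∈ W_J`, it is one of `s t`, and the exchange condition
applies to that word. -/
lemma commute_of_conj_mem_standardParabolic {J : Set B} {s t : B} (hs : s ∉ J)
    (h : cs.simple s * cs.simple t * cs.simple s ∈ cs.standardParabolic J) :
    Commute (cs.simple s) (cs.simple t) := by
  have h1 : ¬ cs.IsRightDescent (cs.simple s * cs.simple t * cs.simple s) s :=
    fun h' => hs (cs.mem_of_isRightDescent h h')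
  have h2 : cs.IsRightDescent (cs.wordProd [s, t]) s := by
    rw [cs.not_isRightDescent_iff, cs.simple_mul_simple_cancel_right] at h1
    rw [IsRightDescent, wordProd_cons, wordProd_singleton]
    omega
  have h3 := cs.simple_mem_rightInvSeq h2
  simp only [rightInvSeq, wordProd_singleton, wordProd_nil, inv_simple, mem_cons, not_mem_nil,
    or_false, mul_one, inv_one, one_mul] at h3
  rcases h3 with h3 | h3
  · calc cs.simple s * cs.simple t = cs.simple t * cs.simple s * cs.simple t * cs.simple t := by
          rw [← h3]
      _ = _ := by simp
  · rw [h3]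

/-- If `s ∉ J` and both `g` and `s g s` lie in `W_J`, then `g` is a product of simple reflections
that commute with `s`. -/
lemma mem_standardParabolic_commute {J : Set B} {s : B} (hs : s ∉ J) {g : W}
    (hg : g ∈ cs.standardParabolic J)
    (hg' : cs.simple s * g * cs.simple s ∈ cs.standardParabolic J) :
    g ∈ cs.standardParabolic {t ∈ J | Commute (cs.simple s) (cs.simple t)} := by
  refine cs.standardParabolic_induction
    (p := fun g => cs.simple s * g * cs.simple s ∈ cs.standardParabolic J →
      g ∈ cs.standardParabolic {t ∈ J | Commute (cs.simple s) (cs.simple t)})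
    (fun _ => one_mem _) ?_ hg hg'
  · intro u hu t ht h ih hg'
    have hg : u * cs.simple t ∈ cs.standardParabolic J :=
      mul_mem hu (cs.simple_mem_standardParabolic ht)
    have hst : s ≠ t := fun e => hs (e ▸ ht)
    -- `s` is not a left descent of an element of `W_J`
    have hdesc : cs.length (cs.simple s * (u * cs.simple t)) = cs.length (u * cs.simple t) + 1 := by
      refine cs.not_isLeftDescent_iff.1 fun h' => hs ?_
      exact cs.mem_of_isRightDescent (inv_mem hg) (cs.isRightDescent_inv_iff.2 h')
    obtain ⟨ω, hω, hω'⟩ := cs.exists_word_of_mem_standardParabolic hg'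
    have h1 : cs.IsRightDescent (cs.wordProd ω * cs.simple s) t := by
      rw [hω', cs.simple_mul_simple_cancel_right, IsRightDescent, hdesc, mul_assoc,
        cs.simple_mul_simple_cancel_right]
      have := cs.length_mul_le (cs.simple s) u
      rw [cs.length_simple] at this
      omega
    have h2 : cs.simple s * cs.simple t * cs.simple s ∈ cs.standardParabolic J := by
      rcases cs.isRightDescent_or_conj_mem_rightInvSeq h1 with h2 | h2
      · rw [← cs.wordProd_singleton s] at h2
        have := cs.simple_mem_rightInvSeq h2
        rw [rightInvSeq_singleton, mem_singleton] at this
        exact absurd (cs.simple_injective this).symm hst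
      · rw [inv_simple] at h2
        exact cs.mem_standardParabolic_of_mem_rightInvSeq hω h2
    have hcomm := cs.commute_of_conj_mem_standardParabolic hs h2
    refine mul_mem (ih ?_) (cs.simple_mem_standardParabolic ⟨ht, hcomm⟩)
    have := mul_mem hg' h2
    simpa [mul_assoc] using this

/-! ### Normal subgroups inside a standard parabolic subgroup -/

/-- In an irreducible Coxeter group, a normal subgroup contained in a proper standard parabolic
subgroup is trivial. -/
lemma eq_bot_of_normal_of_le_standardParabolic (hirr : M.IsIrreducible) {K : Subgroup W}
    [hK : K.Normal] {r : B} (hKr : K ≤ cs.standardParabolic {r}ᶜ) : K = ⊥ := by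
  have step : ∀ s, K ≤ cs.standardParabolic {s}ᶜ := by
    intro s
    have hreach := hirr.preconnected r s
    rw [SimpleGraph.reachable_iff_reflTransGen] at hreach
    induction hreach with
    | refl => exact hKr
    | @tail s t _ hst ih =>
      intro k hk
      have hk' : cs.simple s * k * cs.simple s ∈ K := by
        simpa using hK.conj_mem k hk (cs.simple s)
      refine Subgroup.closure_mono (Set.image_mono ?_)
        (cs.mem_standardParabolic_commute (by simp) (ih hk) (ih hk'))
      rintro _ ⟨_, hx⟩ rfl
      exact cs.not_adj_of_commute hx hst
  rw [eq_bot_iff]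
  intro k hk
  by_contra hne
  obtain ⟨i, hi⟩ := cs.exists_rightDescent_of_ne_one hne
  exact cs.mem_of_isRightDescent (step i hk) hi rfl

/-! ### Normalizers of maximal standard parabolic subgroups -/

/-- A nontrivial element `w` of minimal length in `w W_I` that normalizes the maximal standard
parabolic subgroup `W_I`, where `I = S \ {r}`, has `r` as a descent on all of `w W_I`: if
`w x = x' w` with `x, x' ∈ W_I`, then lengths add on both sides and `w` ends with `r`. -/
lemma isRightDescent_mul_of_mem_normalizer {r : B} {w : W}
    (hw : w ∈ Subgroup.normalizer (cs.standardParabolic {r}ᶜ : Set W))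
    (hmin : ∀ x ∈ cs.standardParabolic {r}ᶜ, cs.length w ≤ cs.length (w * x)) (hne : w ≠ 1)
    {x : W} (hx : x ∈ cs.standardParabolic {r}ᶜ) : cs.IsRightDescent (w * x) r := by
  have hr : cs.IsRightDescent w r := by
    obtain ⟨i, hi⟩ := cs.exists_rightDescent_of_ne_one hne
    by_cases hir : i = r
    · exact hir ▸ hi
    · exact absurd hi (not_lt.2 (hmin _ (cs.simple_mem_standardParabolic hir)))
  rw [Subgroup.mem_normalizer_iff] at hw
  -- `w` is also of minimal length in `W_I w = w W_I`
  have hmin' : ∀ y ∈ cs.standardParabolic {r}ᶜ, cs.length w⁻¹ ≤ cs.length (w⁻¹ * y) := by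
    intro y hy
    have h1 : w⁻¹ * y⁻¹ * w ∈ cs.standardParabolic {r}ᶜ :=
      (hw _).2 (by simpa [mul_assoc] using inv_mem hy)
    have h2 := hmin _ h1
    rw [← cs.length_inv (w⁻¹ * y), cs.length_inv]
    simpa [mul_assoc] using h2
  have hx' := (hw x).1 hx
  have h1 := cs.length_mul_of_forall_length_le hmin hx
  have h2 := cs.length_mul_of_forall_length_le hmin' (inv_mem hx')
  rw [← mul_inv_rev, cs.length_inv, cs.length_inv, cs.length_inv, inv_mul_cancel_right, h1] at h2
  have h3 := cs.length_mul_le (w * x * w⁻¹) (w * cs.simple r)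
  rw [← mul_assoc, inv_mul_cancel_right] at h3
  rw [IsRightDescent] at hr ⊢
  omega

/-- If the reflections conjugate to `s_r` under `W_I`, where `I = S \ {r}`, are finite in number and
the group is irreducible, then `W_I` is finite: the elements of `W_I` commuting with all these
reflections form a normal subgroup of the whole group, which is therefore trivial. -/
lemma finite_standardParabolic_of_finite_orbit (hirr : M.IsIrreducible) {r : B}
    (hfin : {t | ∃ x ∈ cs.standardParabolic {r}ᶜ, t = x * cs.simple r * x⁻¹}.Finite) :
    Finite (cs.standardParabolic {r}ᶜ) := by
  set P := cs.standardParabolic {r}ᶜ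
  set O := {t | ∃ x ∈ P, t = x * cs.simple r * x⁻¹} with hO
  have hrO : cs.simple r ∈ O := by rw [hO]; exact ⟨1, one_mem _, by simp⟩
  have hconj : ∀ x ∈ P, ∀ t ∈ O, x * t * x⁻¹ ∈ O := by
    rw [hO]
    rintro x hx _ ⟨y, hy, rfl⟩
    exact ⟨x * y, mul_mem hx hy, by simp [mul_assoc]⟩
  set K := P ⊓ Subgroup.centralizer O
  have hnorm : Subgroup.normalizer (K : Set W) = ⊤ := by
    rw [eq_top_iff, ← cs.subgroup_closure_range_simple, Subgroup.closure_le]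
    have key : ∀ i, ∀ k ∈ K, cs.simple i * k * cs.simple i ∈ K := by
      intro i k hk
      obtain ⟨hkP, hkO⟩ := Subgroup.mem_inf.1 hk
      rw [Subgroup.mem_centralizer_iff] at hkO
      by_cases hir : i = r
      · rw [hir, hkO _ hrO, cs.simple_mul_simple_cancel_right]
        exact ⟨hkP, Subgroup.mem_centralizer_iff.2 hkO⟩
      · have hi : cs.simple i ∈ P := cs.simple_mem_standardParabolic hir
        refine ⟨mul_mem (mul_mem hi hkP) hi, Subgroup.mem_centralizer_iff.2 fun t ht => ?_⟩
        have h1 := hkO _ (hconj _ hi t ht)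
        rw [inv_simple] at h1
        calc t * (cs.simple i * k * cs.simple i)
            = cs.simple i * (cs.simple i * t * cs.simple i * k) * cs.simple i := by
              simp [mul_assoc]
          _ = cs.simple i * k * cs.simple i * t := by rw [h1]; simp [mul_assoc]
    rintro _ ⟨i, rfl⟩
    rw [SetLike.mem_coe, Subgroup.mem_normalizer_iff]
    intro k
    rw [inv_simple]
    refine ⟨key i k, fun h => ?_⟩
    simpa [mul_assoc] using key i _ h
  have : K.Normal := Subgroup.normalizer_eq_top_iff.1 hnorm
  have hbot : K = ⊥ := cs.eq_bot_of_normal_of_le_standardParabolic hirr inf_le_left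
  have : Finite O := hfin
  -- the conjugation action of `W_I` on `O` is faithful
  refine Finite.of_injective
    (fun (x : P) (t : O) => (⟨x * t * (x : W)⁻¹, hconj x x.2 t t.2⟩ : O)) fun x y hxy => ?_
  have hmem : (y : W)⁻¹ * x ∈ K := by
    refine Subgroup.mem_inf.2 ⟨mul_mem (inv_mem y.2) x.2, Subgroup.mem_centralizer_iff.2 fun t ht => ?_⟩
    have h1 : (x : W) * t * (x : W)⁻¹ = y * t * (y : W)⁻¹ :=
      congrArg Subtype.val (congrFun hxy ⟨t, ht⟩)
    rw [mul_inv_eq_iff_eq_mul] at h1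
    simp [mul_assoc, h1]
  rw [hbot, Subgroup.mem_bot, inv_mul_eq_one] at hmem
  exact Subtype.ext hmem.symm

/-- A maximal standard parabolic subgroup of an irreducible infinite Coxeter group of finite rank is
self-normalizing. -/
theorem normalizer_standardParabolic_compl_singleton [Finite B] [Infinite W]
    (hirr : M.IsIrreducible) (r : B) :
    Subgroup.normalizer (cs.standardParabolic {r}ᶜ : Set W) = cs.standardParabolic {r}ᶜ := by
  set P := cs.standardParabolic {r}ᶜ
  refine le_antisymm (fun v hv => ?_) Subgroup.le_normalizer
  obtain ⟨y, hy, hymin⟩ : ∃ y ∈ P, ∀ x ∈ P, cs.length (v * y) ≤ cs.length (v * x) := by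
    let f : P → ℕ := fun x => cs.length (v * x)
    exact ⟨(Function.argmin f : P), (Function.argmin f).2, fun x hx => Function.argmin_le f ⟨x, hx⟩⟩
  set w := v * y with hw
  have hwN : w ∈ Subgroup.normalizer (P : Set W) := mul_mem hv (Subgroup.le_normalizer hy)
  have hwmin : ∀ x ∈ P, cs.length w ≤ cs.length (w * x) := fun x hx => by
    rw [hw, mul_assoc]
    exact hymin _ (mul_mem hy hx)
  by_contra hvP
  have hne : w ≠ 1 := fun h => hvP (by rw [eq_inv_of_mul_eq_one_left h]; exact inv_mem hy)
  have hdesc : ∀ x ∈ P, cs.IsRightDescent (w * x) r := fun x hx =>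
    cs.isRightDescent_mul_of_mem_normalizer hwN hwmin hne hx
  obtain ⟨ω, hω⟩ := cs.wordProd_surjective w
  have hPfin : Finite P := by
    refine cs.finite_standardParabolic_of_finite_orbit hirr
      ((cs.rightInvSeq ω).finite_toSet.subset ?_)
    rintro _ ⟨x, hx, rfl⟩
    have h1 := hdesc x hx
    rw [← hω] at h1
    exact (cs.isRightDescent_or_conj_mem_rightInvSeq h1).resolve_left
      fun h => cs.mem_of_isRightDescent hx h rfl
  obtain ⟨x, hx⟩ := Finite.exists_max fun x : P => cs.length (x : W)
  have hfin : Finite W := by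
    refine cs.finite_of_forall_isRightDescent (z := w * x) fun i => ?_
    by_cases hir : i = r
    · exact hir ▸ hdesc x x.2
    · have hxi : (x : W) * cs.simple i ∈ P := mul_mem x.2 (cs.simple_mem_standardParabolic hir)
      have h1 : cs.length (x * cs.simple i) ≤ cs.length (x : W) := hx ⟨_, hxi⟩
      have h2 := cs.length_mul_simple_ne (x : W) i
      rw [IsRightDescent, mul_assoc, cs.length_mul_of_forall_length_le hwmin hxi,
        cs.length_mul_of_forall_length_le hwmin x.2]
      have := lt_of_le_of_ne h1 h2
      omega
  exact not_finite W

end CoxeterSystem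

theorem corollary2p10 {B W : Type*} [Fintype B] [Group W] {M : CoxeterMatrix B}
    (cs : CoxeterSystem M W) (hirr : M.IsIrreducible) (hinf : Infinite W)
    (n : ℕ) (hn : Fintype.card B = n) (I : Finset B) (hI : (I.card : ℤ) = n - 1) :
    Subgroup.normalizer (cs.standardParabolic (I : Set B) : Set W) =
      cs.standardParabolic (I : Set B) := by
  classical
  obtain ⟨r, hr⟩ : ∃ r, Iᶜ = {r} := by
    rw [← Finset.card_eq_one, Finset.card_compl]
    omega
  have hIr : (I : Set B) = {r}ᶜ := by
    rw [← compl_compl (I : Set B), ← Finset.coe_compl, hr, Finset.coe_singleton]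
  rw [hIr]
  exact cs.normalizer_standardParabolic_compl_singleton hirr r
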